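/- Every rational $x\in[0,1]$ has a unique finite odd continued fraction $$x=1+\cfrac{\varepsilon_1}{a_1+\cfrac{\varepsilon_2}{a_2+\cdots+\cfrac{\varepsilon_l}{a_l}}},\qquad l\ge 0,$$ with $a_j$ odd positive integers, $\varepsilon_j=\pm1$, $\varepsilon_1=-1$, $a_j+\varepsilon_{j+1}\ge 2$ for $1\le j<l$, and, if $l\ge2$ and $a_l=1$, $\varepsilon_l=1$. Let $S(x)=a_1+\cdots+a_l$, let $\mathcal M_n=\{x\in\mathbb Q\cap[0,1]: S(x)\le n+1\}$, and let $$F(x)=\lim_{n\to\infty}\frac{\#\{\xi\in\mathcal M_n:\xi\le x\}}{\#\mathcal M_n},\qquad x\in[0,1],$$ be the limit distribution function of the sequence $\mathcal M_n$. Let $\lambda$ be the unique real root of $\lambda^3-\lambda^2-\lambda-1=0$. Then the limit $F(x)$ exists for every $x\in[0,1]$, and for every integer $n\ge1$ and every $x\in[0,1]$, $$\frac{1-F(1-x)}{\lambda^{2n-1}}=\frac1{\lambda^{2n-2}}-1+F\left(1-\frac1{2n-1+x}\right),$$ $$\frac{1-F(1-x)}{\lambda^{2n}}=1-F\left(1-\frac{1}{2n+\frac1x}\right),$$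 where in the second equation $\frac{1}{2n+1/x}$ is read as $0$ for $x=0$. -/

import Mathlib

open Filter Topology

/-- The value of the fraction `ε₁ / (a₁ + ε₂ / (a₂ + ⋯ + ε_l / a_l))` attached to the list
`[(ε₁, a₁), …, (ε_l, a_l)]`; the empty list has value `0`. -/
def oddTail : List (ℤ × ℕ) → ℚ
  | [] => 0
  | (e, a) :: t => (e : ℚ) / ((a : ℚ) + oddTail t)

/-- The list `[(ε₁, a₁), …, (ε_l, a_l)]` is admissible for the finite odd continued fraction
`[1; ε₁/a₁, …, ε_l/a_l]`: the signs are `±1`, the `a_j` are odd, `ε₁ = -1`,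
`a_j + ε_{j+1} ≥ 2`, and a last partial quotient `1` carries the sign `+1`.
The last condition only serves to make representations unique. It is not imposed when `l = 1`,
where the sign is forced to be `-1`: the number `0 = 1 - 1/1` has no other representation. -/
structure IsOddCF (c : List (ℤ × ℕ)) : Prop where
  sign : ∀ p ∈ c, p.1 = 1 ∨ p.1 = -1
  odd : ∀ p ∈ c, Odd p.2
  first : ∀ p ∈ c.head?, p.1 = -1
  step : c.IsChain (fun p q => 2 ≤ (p.2 : ℤ) + q.1)
  last : 2 ≤ c.length → ∀ p ∈ c.getLast?, p.2 = 1 → p.1 = 1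

/-- `c` is the odd continued fraction representation `x = [1; ε₁/a₁, …, ε_l/a_l]`
of the rational number `x`. -/
def RepresentsOdd (c : List (ℤ × ℕ)) (x : ℚ) : Prop :=
  IsOddCF c ∧ 1 + oddTail c = x

/-- The sum `a₁ + ⋯ + a_l` of the partial quotients. -/
def quotientSum (c : List (ℤ × ℕ)) : ℕ := (c.map Prod.snd).sum

/-- `ℳ_n`: the rationals in `[0, 1]` whose odd continued fraction has sum of partial quotients
at most `n + 1`. -/
def oddM (n : ℕ) : Set ℚ :=
  {x | x ∈ Set.Icc (0 : ℚ) 1 ∧ ∃ c, RepresentsOdd c x ∧ quotientSum c ≤ n + 1}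

/-- `F_n(x) = #{ξ ∈ ℳ_n : ξ ≤ x} / #ℳ_n`. -/
noncomputable def oddFn (n : ℕ) (x : ℝ) : ℝ :=
  ({ξ : ℚ | ξ ∈ oddM n ∧ (ξ : ℝ) ≤ x}.ncard : ℝ) / ((oddM n).ncard : ℝ)

/-- The limit distribution function `F(x) = lim F_n(x)` of the sequence `ℳ_n`. -/
noncomputable def oddF (x : ℝ) : ℝ := limUnder atTop (fun n : ℕ => oddFn n x)

theorem existsUnique_tribonacci_root :
    ∃! t : ℝ, t ^ 3 - t ^ 2 - t - 1 = 0 := by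
  have hc : ContinuousOn (fun t : ℝ => t ^ 3 - t ^ 2 - t - 1) (Set.Icc 1 2) := by fun_prop
  obtain ⟨t, ht, h0⟩ := intermediate_value_Icc (by norm_num : (1 : ℝ) ≤ 2) hc
    (show (0 : ℝ) ∈ Set.Icc _ _ by constructor <;> norm_num)
  have h0' : t ^ 3 - t ^ 2 - t - 1 = 0 := h0
  refine ⟨t, h0', fun s hs => ?_⟩
  have hs' : s ^ 3 - s ^ 2 - s - 1 = 0 := hs
  have h1 : 1 < s := by
    by_contra h
    push Not at h
    nlinarith [mul_nonneg (sub_nonneg.mpr h) (sq_nonneg (s + 1))]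
  have h2 : 1 < t := by
    by_contra h
    push Not at h
    nlinarith [mul_nonneg (sub_nonneg.mpr h) (sq_nonneg (t + 1))]
  have hf : (s - t) * (s ^ 2 + s * t + t ^ 2 - s - t - 1) = 0 := by linear_combination hs' - h0'
  rcases mul_eq_zero.mp hf with h | h
  · linarith
  · nlinarith [mul_pos (sub_pos.mpr h1) (sub_pos.mpr h2)]

/-- The unique real root `λ` of `t³ - t² - t - 1 = 0`. -/
noncomputable def oddLambda : ℝ := Classical.choose existsUnique_tribonacci_root.exists

theorem oddLambda_spec : oddLambda ^ 3 - oddLambda ^ 2 - oddLambda - 1 = 0 :=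
  Classical.choose_spec existsUnique_tribonacci_root.exists

/-! Reflect to η = 1 - x, so that the leading digit gives η = 1/(a₁ ± θ) with θ again such a number.
Three maps of [0,1] act simply on digits: x ↦ 1/(1+x) prepends a digit 1, x ↦ x/(1+2x) raises the
first digit by 2 (fixing 0), and x ↦ 1/(3-x), for 0 < x < 1, prepends a digit 3 followed by a minus
sign. They raise the digit sum of nonzero numbers by 1, 2, 3, and their images [1/2,1], [0,1/3],
[1/3,1/2] cover [0,1].

Let N_s(y) count the η < y with digit sum at most s (`tailCount`). Each map yields a recursion for
N_s. At y = 1 they combine to a tribonacci recurrence, so N_s(1)/λ^s → c > 0. For general y each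
recursion expresses N_s(y)/λ^s as a convergent term plus λ⁻¹, λ⁻² or λ⁻³ times the same ratio at
another point, up to sign; iterating shrinks the asymptotic oscillation to 0
(`tailCount_oscillation`).

Hence N_s(y)/λ^s → c(1 - F(1-y)), and the recursions pass to the limit. Iterating the second map
gives the equation in λ^(2n); starting from 1/(1+x) gives the other. Uniqueness of expansions is
never needed separately. -/

/-! ### Peeling off the first digit -/

theorem oddTail_cons_eq (e : ℤ) (b : ℕ) (d : List (ℤ × ℕ)) :
    oddTail ((e, b) :: d) = e * -oddTail ((-1, b) :: d) := by
  simp only [oddTail]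
  push_cast
  ring

theorem IsOddCF.nil : IsOddCF [] := by
  constructor <;> simp

theorem IsOddCF.singleton {a : ℕ} (ha : Odd a) : IsOddCF [(-1, a)] := by
  constructor <;> simp [ha]

/-- Resetting the sign of the second digit to -1 makes the remaining list admissible, which is what
allows recursion on lists. -/
theorem IsOddCF.cons_iff {e₀ e : ℤ} {a b : ℕ} {d : List (ℤ × ℕ)} :
    IsOddCF ((e₀, a) :: (e, b) :: d) ↔
      e₀ = -1 ∧ Odd a ∧ (e = 1 ∨ e = -1) ∧ 2 ≤ (a : ℤ) + e ∧ (d = [] → b = 1 → e = 1) ∧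
        IsOddCF ((-1, b) :: d) := by
  constructor
  · intro h
    obtain ⟨h1, h2, h3, h4, h5⟩ := h
    have h4' := List.isChain_cons_cons.1 h4
    have h4'' := List.isChain_cons.1 h4'.2
    refine ⟨by simpa using h3, h2 (e₀, a) (by simp), h1 (e, b) (by simp), h4'.1, ?_, ?_⟩
    · rintro rfl
      simpa using h5
    · refine ⟨?_, ?_, by simp, ?_, ?_⟩
      · intro p hp
        rcases List.mem_cons.1 hp with rfl | hp
        · simp
        · exact h1 p (by simp [hp])
      · intro p hp
        rcases List.mem_cons.1 hp with rfl | hp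
        · exact h2 (e, b) (by simp)
        · exact h2 p (by simp [hp])
      · exact List.isChain_cons.2 h4''
      · intro hl
        cases d with
        | nil => simp at hl
        | cons q d => simpa using h5
  · rintro ⟨rfl, ha, he, hs, hl, h1, h2, h3, h4, h5⟩
    have h4' := List.isChain_cons.1 h4
    refine ⟨?_, ?_, by simp, ?_, ?_⟩
    · intro p hp
      rcases List.mem_cons.1 hp with rfl | hp
      · simp
      rcases List.mem_cons.1 hp with rfl | hp
      · exact he
      · exact h1 p (by simp [hp])
    · intro p hp
      rcases List.mem_cons.1 hp with rfl | hp
      · exact ha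
      rcases List.mem_cons.1 hp with rfl | hp
      · exact h2 (-1, b) (by simp)
      · exact h2 p (by simp [hp])
    · exact List.isChain_cons_cons.2 ⟨hs, List.isChain_cons.2 h4'⟩
    · intro _
      cases d with
      | nil => simpa using hl
      | cons q d => simpa using h5

/-- The step condition keeps every denominator with a further digit above 1, so the value 1 comes
only from the single digit 1. This equality case is where the convention on a last digit 1 enters.
-/
theorem IsOddCF.neg_oddTail_bounds {b : ℕ} {d : List (ℤ × ℕ)} (h : IsOddCF ((-1, b) :: d)) :
    0 < -oddTail ((-1, b) :: d) ∧ -oddTail ((-1, b) :: d) ≤ 1 ∧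
      (-oddTail ((-1, b) :: d) = 1 → b = 1 ∧ d = []) := by
  induction d generalizing b with
  | nil =>
    have hb := h.odd (-1, b) (by simp)
    have hb1 : (1 : ℚ) ≤ b := by exact_mod_cast hb.pos
    have e : -oddTail [((-1 : ℤ), b)] = 1 / (b : ℚ) := by simp [oddTail]; ring
    rw [e]
    refine ⟨by positivity, (div_le_one (by linarith)).2 hb1, fun h1 => ?_⟩
    rw [div_eq_one_iff_eq (by positivity)] at h1
    exact ⟨by exact_mod_cast h1.symm, rfl⟩
  | cons p d ih =>
    obtain ⟨e, c⟩ := p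
    obtain ⟨-, ha, he, hs, -, hd⟩ := IsOddCF.cons_iff.1 h
    obtain ⟨i0, i1, -⟩ := ih hd
    have hb1 : (1 : ℚ) ≤ b := by exact_mod_cast ha.pos
    have hs' : (2 : ℚ) ≤ b + e := by exact_mod_cast hs
    have ev : -oddTail (((-1 : ℤ), b) :: (e, c) :: d) =
        1 / ((b : ℚ) + e * -oddTail ((-1, c) :: d)) := by
      rw [← oddTail_cons_eq]
      conv_lhs => rw [oddTail]
      push_cast
      ring
    have key : 1 < (b : ℚ) + e * -oddTail ((-1, c) :: d) := by
      rcases he with rfl | rfl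
      · push_cast; linarith
      · have hb3 : (3 : ℚ) ≤ b := by push_cast at hs'; linarith
        push_cast; linarith
    rw [ev]
    have lt1 : 1 / ((b : ℚ) + e * -oddTail ((-1, c) :: d)) < 1 :=
      (div_lt_one (by linarith)).2 key
    exact ⟨by positivity, lt1.le, fun h1 => absurd h1 lt1.ne⟩

/-! ### Reflected values and the three digit maps -/

/-- The numbers `1 - x`, for `x` with an odd continued fraction of quotient sum at most `s`. -/
def tailSet (s : ℕ) : Set ℚ :=
  {η | ∃ c, IsOddCF c ∧ -oddTail c = η ∧ quotientSum c ≤ s}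

theorem zero_mem_tailSet (s : ℕ) : (0 : ℚ) ∈ tailSet s :=
  ⟨[], IsOddCF.nil, by simp [oddTail], by simp [quotientSum]⟩

theorem IsOddCF.eq_nil_or {c : List (ℤ × ℕ)} (h : IsOddCF c) :
    c = [] ∨ ∃ b d, c = (-1, b) :: d := by
  rcases c with _ | ⟨⟨e, b⟩, d⟩
  · simp
  · have := h.first (e, b) (by simp)
    right
    exact ⟨b, d, by simp_all⟩

theorem tailSet_subset_Icc (s : ℕ) : tailSet s ⊆ Set.Icc 0 1 := by
  rintro η ⟨c, hc, rfl, -⟩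
  rcases hc.eq_nil_or with rfl | ⟨b, d, rfl⟩
  · simp [oddTail]
  · exact ⟨hc.neg_oddTail_bounds.1.le, hc.neg_oddTail_bounds.2.1⟩

/-- Here θ = 0 encodes termination after a. In the minus branch, 3 ≤ a is the step condition and θ <
1 is the rule excluding a final digit 1 with sign -1. -/
theorem mem_tailSet_iff {s : ℕ} {η : ℚ} :
    η ∈ tailSet s ↔ η = 0 ∨ ∃ a, Odd a ∧ a ≤ s ∧ ∃ θ ∈ tailSet (s - a),
      η = 1 / (a + θ) ∨ (3 ≤ a ∧ 0 < θ ∧ θ < 1 ∧ η = 1 / (a - θ)) := by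
  constructor
  · rintro ⟨c, hc, rfl, hq⟩
    rcases hc.eq_nil_or with rfl | ⟨a, d, rfl⟩
    · simp [oddTail]
    right
    have ha := hc.odd (-1, a) (by simp)
    have hq' : a + quotientSum d ≤ s := by simpa [quotientSum] using hq
    refine ⟨a, ha, by omega, ?_⟩
    rcases d with _ | ⟨⟨e, b⟩, d⟩
    · refine ⟨0, zero_mem_tailSet _, Or.inl ?_⟩
      simp [oddTail]; ring
    · obtain ⟨-, -, he, hs, hl, hd⟩ := IsOddCF.cons_iff.1 hc
      obtain ⟨i0, i1, i2⟩ := hd.neg_oddTail_bounds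
      refine ⟨_, ⟨_, hd, rfl, ?_⟩, ?_⟩
      · simp only [quotientSum, List.map_cons, List.sum_cons] at hq' ⊢
        omega
      · have ev : -oddTail (((-1 : ℤ), a) :: (e, b) :: d) =
            1 / ((a : ℚ) + e * -oddTail ((-1, b) :: d)) := by
          rw [← oddTail_cons_eq]
          conv_lhs => rw [oddTail]
          push_cast
          ring
        rw [ev]
        rcases he with rfl | rfl
        · left; simp
        · right
          refine ⟨by omega, i0, lt_of_le_of_ne i1 fun h => ?_, by simp [sub_eq_add_neg]⟩
          have := hl (i2 h).2 (i2 h).1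
          omega
  · rintro (rfl | ⟨a, ha, has, θ, ⟨c, hc, rfl, hq⟩, h⟩)
    · exact zero_mem_tailSet s
    rcases hc.eq_nil_or with rfl | ⟨b, d, rfl⟩
    · rcases h with h | h
      · refine ⟨[(-1, a)], IsOddCF.singleton ha, ?_, by simpa [quotientSum] using has⟩
        rw [h]; simp [oddTail]; ring
      · simp [oddTail] at h
    · obtain ⟨i0, i1, i2⟩ := hc.neg_oddTail_bounds
      have hq' : a + quotientSum ((-1, b) :: d) ≤ s := by omega
      have ev (e : ℤ) : -oddTail (((-1 : ℤ), a) :: (e, b) :: d) =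
            1 / ((a : ℚ) + e * -oddTail ((-1, b) :: d)) := by
          rw [← oddTail_cons_eq]
          conv_lhs => rw [oddTail]
          push_cast
          ring
      have hap := ha.pos
      rcases h with h | ⟨h3, -, h1, h⟩
      · refine ⟨(-1, a) :: (1, b) :: d, IsOddCF.cons_iff.2
          ⟨rfl, ha, Or.inl rfl, by omega, fun _ _ => rfl, hc⟩, ?_, by
            simpa [quotientSum] using hq'⟩
        rw [h, ev]; simp
      · refine ⟨(-1, a) :: (-1, b) :: d, IsOddCF.cons_iff.2
          ⟨rfl, ha, Or.inr rfl, by omega, ?_, hc⟩, ?_, by simpa [quotientSum] using hq'⟩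
        · rintro rfl rfl
          simp [oddTail] at h1
        · rw [h, ev]; simp [sub_eq_add_neg]

theorem mem_oddM_iff {n : ℕ} {x : ℚ} : x ∈ oddM n ↔ 1 - x ∈ tailSet (n + 1) := by
  constructor
  · rintro ⟨-, c, ⟨hc, h⟩, hq⟩
    exact ⟨c, hc, by linarith, hq⟩
  · intro hx
    have hx' := tailSet_subset_Icc _ hx
    obtain ⟨c, hc, h, hq⟩ := hx
    exact ⟨⟨by linarith [hx'.2], by linarith [hx'.1]⟩, c, ⟨hc, by linarith⟩, hq⟩

/-- The denominator 1 + x is at most 2, while a first digit a ≥ 3 gives a denominator above 2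
(strictly, since θ < 1 after a minus sign). So the first digit is 1. -/
theorem one_div_one_add_mem_tailSet_iff {s : ℕ} {x : ℚ} (h0 : 0 ≤ x) (h1 : x ≤ 1) :
    1 / (1 + x) ∈ tailSet (s + 1) ↔ x ∈ tailSet s := by
  rw [mem_tailSet_iff]
  constructor
  · rintro (h | ⟨a, ha, has, θ, hθ, h⟩)
    · have : 0 < 1 / (1 + x) := by positivity
      linarith
    have hb := tailSet_subset_Icc _ hθ
    rcases Nat.lt_or_ge a 3 with h3 | h3
    · obtain rfl : a = 1 := by
        have := ha.pos
        interval_cases a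
        · rfl
        · exact absurd ha (by decide)
      rcases h with h | h
      · have : x = θ := by simpa using h
        subst this
        simpa using hθ
      · omega
    · have h3' : (3 : ℚ) ≤ a := by exact_mod_cast h3
      exfalso
      rcases h with h | ⟨-, p0, p1, h⟩
      · have : 1 + x = a + θ := by simpa only [one_div, inv_inj] using h
        linarith [hb.1]
      · have : 1 + x = a - θ := by simpa only [one_div, inv_inj] using h
        linarith [hb.1]
  · intro hx
    exact Or.inr ⟨1, odd_one, by omega, x, by simpa using hx, Or.inl (by simp)⟩

/-- For x > 0 the number is 1/(2 + 1/x), whose denominator is at least 3. This excludes the first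
digit 1 and also 3 - θ with θ > 0, so lowering the first digit by 2 stays admissible. -/
theorem div_one_add_two_mul_mem_tailSet_iff {s : ℕ} {x : ℚ} (h0 : 0 ≤ x) (h1 : x ≤ 1) :
    x / (1 + 2 * x) ∈ tailSet (s + 2) ↔ x ∈ tailSet s := by
  rcases h0.eq_or_lt with rfl | h0
  · simp [zero_mem_tailSet]
  have e : x / (1 + 2 * x) = 1 / (2 + 1 / x) := by field_simp; ring
  have hx1 : 1 ≤ 1 / x := (one_le_div h0).2 h1
  rw [e, mem_tailSet_iff, mem_tailSet_iff (s := s)]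
  constructor
  · rintro (h | ⟨a, ha, has, θ, hθ, h⟩)
    · have : 0 < 1 / (2 + 1 / x) := by positivity
      linarith
    have hb := tailSet_subset_Icc _ hθ
    obtain ⟨k, rfl⟩ := ha
    have hx : 2 + 1 / x = (2 * k + 1 : ℕ) + θ ∨
        (0 < θ ∧ θ < 1 ∧ 2 + 1 / x = (2 * k + 1 : ℕ) - θ) := by
      rcases h with h | ⟨-, p0, p1, h⟩
      · left; simpa only [one_div, inv_inj] using h
      · right; exact ⟨p0, p1, by simpa only [one_div, inv_inj] using h⟩
    push_cast at hx
    have hk : 1 ≤ k := by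
      by_contra! hk
      obtain rfl : k = 0 := by omega
      rcases hx with h | ⟨p0, p1, h⟩
      · push_cast at h
        linarith [hb.2]
      · push_cast at h; linarith
    obtain ⟨j, rfl⟩ := Nat.exists_eq_add_of_le' hk
    refine Or.inr ⟨2 * j + 1, by simp, by omega, θ, ?_, ?_⟩
    · convert hθ using 2; omega
    · have hx0 : x = 1 / (1 / x) := by simp
      rw [hx0]
      push_cast at hx ⊢
      rcases hx with h | ⟨p0, p1, h⟩
      · left; congr 1; linarith
      · right
        refine ⟨?_, p0, p1, by congr 1; linarith⟩
        by_contra! hj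
        obtain rfl : j = 0 := by omega
        push_cast at h; linarith
  · rintro (h | ⟨a, ha, has, θ, hθ, h⟩)
    · exact absurd h h0.ne'
    refine Or.inr ⟨a + 2, by simpa [Nat.odd_add] using ha, by omega, θ, ?_, ?_⟩
    · convert hθ using 2; omega
    · rcases h with h | ⟨h3, p0, p1, h⟩
      · left; rw [h, one_div_one_div]; push_cast; congr 1; ring
      · right; refine ⟨by omega, p0, p1, ?_⟩
        rw [h, one_div_one_div]; push_cast; congr 1; ring

/-- For 0 < x < 1 the denominator lies strictly between 2 and 3, which forces digit 3 with a minus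
sign. The endpoint x = 1 is excluded: 1/2 is 1/(1+1), of digit sum 2. -/
theorem one_div_three_sub_mem_tailSet_iff {s : ℕ} {x : ℚ} (h0 : 0 ≤ x) (h1 : x < 1) :
    1 / (3 - x) ∈ tailSet (s + 3) ↔ x ∈ tailSet s := by
  rcases h0.eq_or_lt with rfl | h0
  · refine iff_of_true (mem_tailSet_iff.2 (Or.inr ⟨3, by decide, by omega, 0,
      zero_mem_tailSet _, Or.inl (by simp)⟩)) (zero_mem_tailSet s)
  rw [mem_tailSet_iff]
  constructor
  · rintro (h | ⟨a, ha, has, θ, hθ, h⟩)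
    · have : 0 < 1 / (3 - x) := one_div_pos.2 (by linarith)
      linarith
    have hb := tailSet_subset_Icc _ hθ
    obtain ⟨k, rfl⟩ := ha
    rcases h with h | ⟨h3, p0, p1, h⟩
    · have h : 3 - x = (2 * k + 1 : ℕ) + θ := by simpa only [one_div, inv_inj] using h
      exfalso
      push_cast at h
      rcases Nat.lt_or_ge k 1 with hk | hk
      · obtain rfl : k = 0 := by omega
        push_cast at h; linarith [hb.2]
      · have : (1 : ℚ) ≤ k := by exact_mod_cast hk
        linarith [hb.1]
    · have h : 3 - x = (2 * k + 1 : ℕ) - θ := by simpa only [one_div, inv_inj] using h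
      push_cast at h
      rcases Nat.lt_or_ge k 2 with hk | hk
      · obtain rfl : k = 1 := by omega
        push_cast at h
        obtain rfl : x = θ := by linarith
        simpa using hθ
      · have : (2 : ℚ) ≤ k := by exact_mod_cast hk
        linarith [hb.1]
  · intro hx
    exact Or.inr ⟨3, by decide, by omega, x, by simpa using hx,
      Or.inr ⟨le_rfl, h0, h1, by simp⟩⟩

theorem tailSet_finite (s : ℕ) : (tailSet s).Finite := by
  induction s using Nat.strong_induction_on with
  | _ s ih =>
    have hf : (⋃ a ∈ Set.Icc 1 s, ((fun θ : ℚ => 1 / (a + θ)) '' tailSet (s - a) ∪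
        (fun θ : ℚ => 1 / (a - θ)) '' tailSet (s - a))).Finite := by
      refine (Set.finite_Icc 1 s).biUnion fun a ha => ?_
      have := ih (s - a) (by have := ha.1; have := ha.2; omega)
      exact (this.image _).union (this.image _)
    refine (hf.insert 0).subset fun η hη => ?_
    rcases mem_tailSet_iff.1 hη with rfl | ⟨a, ha, has, θ, hθ, h⟩
    · simp
    · refine Or.inr (Set.mem_biUnion (x := a) ⟨ha.pos, has⟩ ?_)
      rcases h with h | ⟨-, -, -, h⟩
      · exact Or.inl ⟨θ, hθ, h.symm⟩
      · exact Or.inr ⟨θ, hθ, h.symm⟩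

theorem one_mem_tailSet (s : ℕ) : (1 : ℚ) ∈ tailSet (s + 1) := by
  simpa using (one_div_one_add_mem_tailSet_iff (s := s) le_rfl zero_le_one).2 (zero_mem_tailSet s)

/-! ### Counting recursions -/

/-- The number of elements of `tailSet s` below `y`. -/
noncomputable def tailCount (s : ℕ) (y : ℝ) : ℕ := {η : ℚ | η ∈ tailSet s ∧ (η : ℝ) < y}.ncard

theorem tailSet_sep_finite (s : ℕ) (p : ℚ → Prop) : {η | η ∈ tailSet s ∧ p η}.Finite :=
  (tailSet_finite s).subset fun _ h => h.1

theorem tailCount_mono (s : ℕ) {y z : ℝ} (h : y ≤ z) : tailCount s y ≤ tailCount s z :=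
  Set.ncard_le_ncard (fun _ hη => ⟨hη.1, hη.2.trans_le h⟩) (tailSet_sep_finite s _)

theorem tailCount_zero (s : ℕ) : tailCount s 0 = 0 := by
  rw [tailCount, Set.ncard_eq_zero (tailSet_sep_finite s _)]
  ext η
  simp only [Set.mem_ofPred_eq, Set.mem_empty_iff_false, iff_false, not_and, not_lt]
  intro h
  exact_mod_cast (tailSet_subset_Icc _ h).1

theorem tailCount_add_ncard_ge (s : ℕ) (y : ℝ) :
    tailCount s y + {η : ℚ | η ∈ tailSet s ∧ y ≤ (η : ℝ)}.ncard = (tailSet s).ncard := by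
  rw [tailCount, ← Set.ncard_union_eq _ (tailSet_sep_finite s _) (tailSet_sep_finite s _)]
  · congr 1
    ext η
    simp only [Set.mem_union, Set.mem_ofPred_eq, ← and_or_left, lt_or_ge, and_true]
  · rw [Set.disjoint_left]
    rintro η ⟨-, h⟩ ⟨-, h'⟩
    exact absurd h (not_lt.2 h')

theorem ncard_tailSet (s : ℕ) : (tailSet (s + 1)).ncard = tailCount (s + 1) 1 + 1 := by
  rw [← tailCount_add_ncard_ge (s + 1) 1]
  congr 1
  rw [Set.ncard_eq_one]
  refine ⟨1, ?_⟩
  ext η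
  simp only [Set.mem_ofPred_eq, Set.mem_singleton_iff]
  constructor
  · rintro ⟨h, h1⟩
    exact le_antisymm (tailSet_subset_Icc _ h).2 (by exact_mod_cast h1)
  · rintro rfl
    exact ⟨one_mem_tailSet s, by simp⟩

/-- The decreasing map 1/(1+x) turns < into ≤; this error of at most one disappears after division
by λ^s. -/
theorem ncard_le_bounds (s : ℕ) (y : ℝ) :
    tailCount s y ≤ {η : ℚ | η ∈ tailSet s ∧ (η : ℝ) ≤ y}.ncard ∧
      {η : ℚ | η ∈ tailSet s ∧ (η : ℝ) ≤ y}.ncard ≤ tailCount s y + 1 := by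
  constructor
  · exact Set.ncard_le_ncard (fun _ h => ⟨h.1, h.2.le⟩) (tailSet_sep_finite s _)
  · have hsub : {η : ℚ | η ∈ tailSet s ∧ (η : ℝ) ≤ y} ⊆
        {η : ℚ | η ∈ tailSet s ∧ (η : ℝ) < y} ∪ {η : ℚ | (η : ℝ) = y} := by
      rintro η ⟨h, h1⟩
      rcases h1.lt_or_eq with h1 | h1
      · exact Or.inl ⟨h, h1⟩
      · exact Or.inr h1
    have hs : {η : ℚ | (η : ℝ) = y}.Subsingleton := by
      intro a ha b hb
      have : (a : ℝ) = b := ha.trans hb.symm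
      exact_mod_cast this
    refine (Set.ncard_le_ncard hsub ((tailSet_sep_finite s _).union hs.finite)).trans ?_
    refine (Set.ncard_union_le _ _).trans ?_
    have := (Set.ncard_le_one hs.finite).2 fun a ha b hb => hs ha hb
    simp only [tailCount]
    omega

theorem tailCount_div_one_add_two_mul (s : ℕ) {y : ℝ} (h0 : 0 ≤ y) (h1 : y ≤ 1) :
    tailCount (s + 2) (y / (1 + 2 * y)) = tailCount s y := by
  have hinj : Set.InjOn (fun x : ℚ => x / (1 + 2 * x)) {η | η ∈ tailSet s ∧ (η : ℝ) < y} := by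
    rintro a ⟨ha, -⟩ b ⟨hb, -⟩ hab
    have ha := (tailSet_subset_Icc _ ha).1
    have hb := (tailSet_subset_Icc _ hb).1
    have hab : a / (1 + 2 * a) = b / (1 + 2 * b) := hab
    rw [div_eq_div_iff (by positivity) (by positivity)] at hab
    linarith
  rw [tailCount, tailCount, ← hinj.ncard_image]
  congr 1
  ext η
  constructor
  · rintro ⟨h, hy⟩
    have hb := tailSet_subset_Icc _ h
    have hη0 : (0 : ℝ) ≤ η := by exact_mod_cast hb.1
    rw [lt_div_iff₀ (by positivity)] at hy
    have hη : (0 : ℝ) < 1 - 2 * η := by nlinarith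
    have hη' : (0 : ℚ) < 1 - 2 * η := by exact_mod_cast hη
    have hlt : (η : ℝ) / (1 - 2 * η) < y := by rw [div_lt_iff₀ hη]; linarith
    have e : η / (1 - 2 * η) / (1 + 2 * (η / (1 - 2 * η))) = η := by
      have h2 : 1 + 2 * (η / (1 - 2 * η)) = 1 / (1 - 2 * η) := by field_simp; ring
      rw [h2, div_div_div_cancel_right₀ hη'.ne', div_one]
    refine ⟨η / (1 - 2 * η), ⟨?_, by push_cast; exact hlt⟩, e⟩
    refine (div_one_add_two_mul_mem_tailSet_iff (div_nonneg hb.1 hη'.le) ?_).1 (by rwa [e])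
    have : (η : ℝ) / (1 - 2 * η) ≤ 1 := hlt.le.trans h1
    exact_mod_cast this
  · rintro ⟨x, ⟨hx, hxy⟩, rfl⟩
    have hb := tailSet_subset_Icc _ hx
    have hx0 : (0 : ℝ) ≤ x := by exact_mod_cast hb.1
    refine ⟨(div_one_add_two_mul_mem_tailSet_iff hb.1 hb.2).2 hx, ?_⟩
    push_cast
    rw [div_lt_div_iff₀ (by positivity) (by positivity)]
    linarith

theorem tailCount_one_div_one_add (s : ℕ) {y : ℝ} (h0 : 0 ≤ y) (h1 : y ≤ 1) :
    tailCount (s + 1) (1 / (1 + y)) + {η : ℚ | η ∈ tailSet s ∧ (η : ℝ) ≤ y}.ncard =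
      (tailSet (s + 1)).ncard := by
  rw [← tailCount_add_ncard_ge (s + 1) (1 / (1 + y))]
  congr 1
  have hinj : Set.InjOn (fun x : ℚ => 1 / (1 + x)) {η | η ∈ tailSet s ∧ (η : ℝ) ≤ y} := by
    rintro a - b - hab
    simpa using hab
  rw [← hinj.ncard_image]
  congr 1
  ext η
  constructor
  · rintro ⟨x, ⟨hx, hxy⟩, rfl⟩
    have hb := tailSet_subset_Icc _ hx
    have hx0 : (0 : ℝ) ≤ x := by exact_mod_cast hb.1
    refine ⟨(one_div_one_add_mem_tailSet_iff hb.1 hb.2).2 hx, ?_⟩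
    push_cast
    exact one_div_le_one_div_of_le (by positivity) (by linarith)
  · rintro ⟨h, hy⟩
    have hb := tailSet_subset_Icc _ h
    have hη : (0 : ℝ) < η := lt_of_lt_of_le (by positivity) hy
    have hη' : (0 : ℚ) < η := by exact_mod_cast hη
    have hle : 1 / (η : ℝ) - 1 ≤ y := by
      rw [div_le_iff₀ (by positivity)] at hy
      rw [sub_le_iff_le_add, div_le_iff₀ hη]
      linarith
    have hle' : 1 / η - 1 ≤ 1 := by exact_mod_cast hle.trans h1
    have hge : 0 ≤ 1 / η - 1 := sub_nonneg.2 ((one_le_div hη').2 hb.2)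
    have e : 1 / (1 + (1 / η - 1)) = η := by simp
    exact ⟨1 / η - 1, ⟨(one_div_one_add_mem_tailSet_iff hge hle').1 (by rwa [e]),
      by push_cast; exact hle⟩, e⟩

theorem tailCount_one_third (s : ℕ) : tailCount (s + 2) (1 / 3) = tailCount s 1 := by
  rw [← tailCount_div_one_add_two_mul s zero_le_one le_rfl]
  norm_num

theorem tailCount_one_div_three_sub (s : ℕ) {y : ℝ} (h0 : 0 ≤ y) (h1 : y ≤ 1) :
    tailCount (s + 3) (1 / (3 - y)) = tailCount (s + 1) 1 + tailCount s y := by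
  rw [← tailCount_one_third (s + 1)]
  have hinj : Set.InjOn (fun x : ℚ => 1 / (3 - x)) {η | η ∈ tailSet s ∧ (η : ℝ) < y} := by
    rintro a - b - hab
    simpa using hab
  rw [tailCount, tailCount, tailCount, ← hinj.ncard_image,
    ← Set.ncard_union_eq _ (tailSet_sep_finite _ _) ((tailSet_sep_finite _ _).image _)]
  · congr 1
    ext η
    constructor
    · rintro ⟨h, hy⟩
      have hb := tailSet_subset_Icc _ h
      rcases lt_or_ge (η : ℝ) (1 / 3) with h3 | h3
      · exact Or.inl ⟨h, h3⟩
      right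
      have hη : (0 : ℝ) < η := by linarith
      have hη' : (0 : ℚ) < η := by exact_mod_cast hη
      have hlt : 3 - 1 / (η : ℝ) < y := by
        rw [lt_div_iff₀ (by linarith)] at hy
        rw [sub_lt_comm, lt_div_iff₀ hη]
        linarith
      have hge : 0 ≤ 3 - 1 / (η : ℝ) := by
        rw [sub_nonneg, div_le_iff₀ hη]; linarith
      have hge' : 0 ≤ 3 - 1 / η := by exact_mod_cast hge
      have hlt' : 3 - 1 / η < 1 := by exact_mod_cast hlt.trans_le h1
      have e : 1 / (3 - (3 - 1 / η)) = η := by simp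
      exact ⟨3 - 1 / η, ⟨(one_div_three_sub_mem_tailSet_iff hge' hlt').1 (by rwa [e]),
        by push_cast; exact hlt⟩, e⟩
    · rintro (⟨h, hy⟩ | ⟨x, ⟨hx, hxy⟩, rfl⟩)
      · refine ⟨h, hy.trans_le (one_div_le_one_div_of_le (by linarith) (by linarith))⟩
      · have hb := tailSet_subset_Icc _ hx
        have hx1 : x < 1 := by exact_mod_cast hxy.trans_le h1
        refine ⟨(one_div_three_sub_mem_tailSet_iff hb.1 hx1).2 hx, ?_⟩
        push_cast
        exact one_div_lt_one_div_of_lt (by linarith) (by linarith)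
  · rw [Set.disjoint_left]
    rintro η ⟨-, h3⟩ ⟨x, ⟨hx, hxy⟩, rfl⟩
    have hx0 : (0 : ℝ) ≤ x := by exact_mod_cast (tailSet_subset_Icc _ hx).1
    refine absurd h3 (not_lt.2 ?_)
    push_cast
    exact one_div_le_one_div_of_le (by linarith) (by linarith)

/-! ### Estimates for λ and growth of tribonacci sequences -/

theorem nine_fifths_lt_oddLambda : 9 / 5 < oddLambda := by
  have h := oddLambda_spec
  have h1 : 1 < oddLambda := by
    by_contra! h1
    nlinarith [mul_nonneg (sub_nonneg.mpr h1) (sq_nonneg (oddLambda + 1))]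
  by_contra! h2
  nlinarith [mul_nonneg (mul_nonneg (sub_nonneg.2 h1.le) (sub_nonneg.2 h2))
    (by linarith : 0 ≤ oddLambda)]

theorem oddLambda_pos : 0 < oddLambda := by linarith [nine_fifths_lt_oddLambda]

theorem inv_oddLambda_le : oddLambda⁻¹ ≤ 5 / 9 := by
  rw [inv_le_comm₀ oddLambda_pos (by norm_num)]
  norm_num
  exact nine_fifths_lt_oddLambda.le

theorem inv_oddLambda_sum : oddLambda⁻¹ + oddLambda⁻¹ ^ 2 + oddLambda⁻¹ ^ 3 = 1 := by
  have h := oddLambda_spec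
  have h0 := oddLambda_pos.ne'
  field_simp
  linarith

theorem tendsto_inv_oddLambda_pow :
    Tendsto (fun s : ℕ => 1 / oddLambda ^ s) atTop (𝓝 0) := by
  have h := tendsto_pow_atTop_nhds_zero_of_lt_one (inv_nonneg.2 oddLambda_pos.le)
    (inv_oddLambda_le.trans_lt (by norm_num))
  simpa [inv_pow] using h

/-- A two-term linear recurrence whose coefficients are dominated by those of the geometric
sequence of ratio `μ < 1` has solutions tending to `0`. -/
theorem tendsto_zero_of_two_term_rec {d : ℕ → ℝ} {α β μ : ℝ} (hα : 0 ≤ α) (hβ : 0 ≤ β)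
    (hμ0 : 0 < μ) (hμ1 : μ < 1) (hμ : α * μ + β ≤ μ ^ 2)
    (hd : ∀ s, d (s + 2) = -(α * d (s + 1)) - β * d s) : Tendsto d atTop (𝓝 0) := by
  have key : ∀ s, |d s| ≤ (|d 0| + |d 1| / μ) * μ ^ s ∧
      |d (s + 1)| ≤ (|d 0| + |d 1| / μ) * μ ^ (s + 1) := by
    intro s
    induction s with
    | zero =>
      constructor
      · simp only [pow_zero, mul_one, le_add_iff_nonneg_right]; positivity
      · rw [zero_add, pow_one, add_mul, div_mul_cancel₀ _ hμ0.ne']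
        simp only [le_add_iff_nonneg_left]; positivity
    | succ s ih =>
      refine ⟨ih.2, ?_⟩
      set B := |d 0| + |d 1| / μ
      have hB : 0 ≤ B := by positivity
      calc |d (s + 1 + 1)| = |-(α * d (s + 1)) - β * d s| := by rw [← hd]
        _ ≤ |-(α * d (s + 1))| + |β * d s| := abs_sub _ _
        _ = α * |d (s + 1)| + β * |d s| := by
          rw [abs_neg, abs_mul, abs_mul, abs_of_nonneg hα, abs_of_nonneg hβ]
        _ ≤ α * (B * μ ^ (s + 1)) + β * (B * μ ^ s) := by gcongr; exacts [ih.2, ih.1]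
        _ = (α * μ + β) * (B * μ ^ s) := by ring
        _ ≤ μ ^ 2 * (B * μ ^ s) := by gcongr
        _ = B * μ ^ (s + 1 + 1) := by ring
  refine squeeze_zero_norm (fun s => (key s).1) ?_
  simpa using (tendsto_pow_atTop_nhds_zero_of_lt_one hμ0.le hμ1).const_mul (|d 0| + |d 1| / μ)

theorem exists_tendsto_div_oddLambda_pow {u : ℕ → ℝ} (hu : ∀ s, 0 < u s)
    (hrec : ∀ s, u (s + 3) = u (s + 2) + u (s + 1) + u s) :
    ∃ c, 0 < c ∧ Tendsto (fun s => u s / oddLambda ^ s) atTop (𝓝 c) := by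
  set x := oddLambda⁻¹ with hx
  have hx0 : 0 < x := inv_pos.2 oddLambda_pos
  have hx1 : x ≤ 5 / 9 := inv_oddLambda_le
  have hsum : x + x ^ 2 + x ^ 3 = 1 := inv_oddLambda_sum
  set v : ℕ → ℝ := fun s => u s * x ^ s with hv
  have hvpos : ∀ s, 0 < v s := fun s => mul_pos (hu s) (by positivity)
  have hvrec : ∀ s, v (s + 3) = x * v (s + 2) + x ^ 2 * v (s + 1) + x ^ 3 * v s := by
    intro s
    simp only [hv, hrec]
    ring
  -- A conserved quantity of the normalised recurrence, whose characteristic polynomial has the root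
  -- 1. The weights 1, x² + x³, x³ sum to 1 + x² + 2x³, so the only possible limit is c below, and v
  -- - c obeys a two-term recurrence.
  set K := v 2 + (x ^ 2 + x ^ 3) * v 1 + x ^ 3 * v 0 with hK
  have hKs : ∀ s, v (s + 2) + (x ^ 2 + x ^ 3) * v (s + 1) + x ^ 3 * v s = K := by
    intro s
    induction s with
    | zero => rfl
    | succ s ih =>
      rw [← ih, hvrec]
      linear_combination v (s + 2) * hsum
  have hKpos : 0 < K := by
    have := hvpos 0; have := hvpos 1; have := hvpos 2
    positivity
  have hDpos : 0 < 1 + x ^ 2 + 2 * x ^ 3 := by positivity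
  have hc : K / (1 + x ^ 2 + 2 * x ^ 3) * (1 + x ^ 2 + 2 * x ^ 3) = K :=
    div_mul_cancel₀ _ hDpos.ne'
  refine ⟨K / (1 + x ^ 2 + 2 * x ^ 3), by positivity, ?_⟩
  set c := K / (1 + x ^ 2 + 2 * x ^ 3)
  have hx2 : x ^ 2 ≤ (5 / 9) ^ 2 := by gcongr
  have hx3 : x ^ 3 ≤ (5 / 9) ^ 3 := by gcongr
  have ht : Tendsto (fun s => v s - c) atTop (𝓝 0) := by
    -- With x ≤ 5/9, the ratio 3/4 satisfies (x² + x³)·3/4 + x³ ≤ 9/16.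
    refine tendsto_zero_of_two_term_rec (α := x ^ 2 + x ^ 3) (β := x ^ 3) (μ := 3 / 4)
      (by positivity) (by positivity) (by norm_num) (by norm_num) (by norm_num at *; linarith) ?_
    intro s
    linear_combination hKs s - hc
  have := ht.add_const c
  simp only [sub_add_cancel, zero_add] at this
  refine this.congr fun s => ?_
  simp only [hv, hx, inv_pow, div_eq_mul_inv]

theorem tailCount_one_pos (s : ℕ) : 0 < tailCount s 1 := by
  rw [tailCount, Set.ncard_pos (tailSet_sep_finite s _)]
  exact ⟨0, zero_mem_tailSet s, by simp⟩

/-- The point 1/2 is both 1/(3-1) and 1/(1+1); equating the two counts below it gives the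
recurrence. -/
theorem tailCount_one_rec (s : ℕ) :
    tailCount (s + 3) 1 = tailCount (s + 2) 1 + tailCount (s + 1) 1 + tailCount s 1 := by
  have h1 := tailCount_one_div_three_sub s zero_le_one le_rfl
  have h2 := tailCount_one_div_one_add (s + 2) zero_le_one le_rfl
  have h3 : {η : ℚ | η ∈ tailSet (s + 2) ∧ (η : ℝ) ≤ 1} = tailSet (s + 2) := by
    ext η
    refine ⟨fun h => h.1, fun h => ⟨h, ?_⟩⟩
    exact_mod_cast (tailSet_subset_Icc _ h).2
  rw [h3, ncard_tailSet (s + 1), ncard_tailSet (s + 2)] at h2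
  rw [show s + 1 + 1 = s + 2 from rfl, show s + 2 + 1 = s + 3 from rfl] at h2
  norm_num at h1 h2
  omega

theorem exists_tendsto_tailCount_one :
    ∃ c, 0 < c ∧ Tendsto (fun s => (tailCount s 1 : ℝ) / oddLambda ^ s) atTop (𝓝 c) :=
  exists_tendsto_div_oddLambda_pow (fun s => by exact_mod_cast tailCount_one_pos s)
    (fun s => by exact_mod_cast tailCount_one_rec s)

theorem tendsto_tailCount_one_div_one_add_add {c : ℝ}
    (hc : Tendsto (fun s => (tailCount s 1 : ℝ) / oddLambda ^ s) atTop (𝓝 c)) {y : ℝ}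
    (h0 : 0 ≤ y) (h1 : y ≤ 1) :
    Tendsto (fun s => (tailCount (s + 1) (1 / (1 + y)) : ℝ) / oddLambda ^ (s + 1) +
      oddLambda⁻¹ * (tailCount s y / oddLambda ^ s)) atTop (𝓝 c) := by
  have hc' := (tendsto_add_atTop_iff_nat 1).2 hc
  have hu := hc'.add ((tendsto_add_atTop_iff_nat 1).2 tendsto_inv_oddLambda_pow)
  rw [add_zero] at hu
  have hL := oddLambda_pos
  have e : ∀ s, (tailCount (s + 1) (1 / (1 + y)) : ℝ) / oddLambda ^ (s + 1) +
      oddLambda⁻¹ * (tailCount s y / oddLambda ^ s) =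
      ((tailCount (s + 1) (1 / (1 + y)) + tailCount s y : ℕ) : ℝ) / oddLambda ^ (s + 1) := by
    intro s
    push_cast
    field_simp
    ring
  refine tendsto_of_tendsto_of_tendsto_of_le_of_le hc' hu (fun s => ?_) (fun s => ?_)
  all_goals
    have k1 := tailCount_one_div_one_add s h0 h1
    have k2 := ncard_le_bounds s y
    rw [ncard_tailSet] at k1
    simp only [e]
  · gcongr; omega
  · rw [← add_div]
    gcongr
    norm_cast
    omega

/-! ### Existence of the limits -/

theorem oscillation_step {a e f : ℕ → ℝ} {k : ℕ} {σ D l : ℝ} (hσ : |σ| ≤ 5 / 9) (hD : 0 < D)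
    (he : Tendsto e atTop (𝓝 l)) (hf : ∃ N, ∀ s ≥ N, ∀ t ≥ N, |f s - f t| ≤ D)
    (ha : ∀ s, a (s + k) = e s + σ * f s) :
    ∃ N, ∀ s ≥ N, ∀ t ≥ N, |a s - a t| ≤ D * (3 / 4) := by
  obtain ⟨N₁, h1⟩ := hf
  -- The slack 1/6 is chosen so that 5/9 + 1/6 = 13/18 < 3/4.
  obtain ⟨N₂, h2⟩ := Metric.cauchySeq_iff.1 he.cauchySeq (D * (1 / 6)) (by positivity)
  refine ⟨max N₁ N₂ + k, fun s hs t ht => ?_⟩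
  obtain ⟨s, rfl⟩ := Nat.exists_eq_add_of_le' (show k ≤ s by omega)
  obtain ⟨t, rfl⟩ := Nat.exists_eq_add_of_le' (show k ≤ t by omega)
  have i1 := h1 s (by omega) t (by omega)
  have i2 := (h2 s (by omega) t (by omega)).le
  rw [Real.dist_eq] at i2
  calc |a (s + k) - a (t + k)| = |(e s - e t) + σ * (f s - f t)| := by rw [ha, ha]; congr 1; ring
    _ ≤ |e s - e t| + |σ| * |f s - f t| := by rw [← abs_mul]; exact abs_add_le _ _
    _ ≤ D * (1 / 6) + 5 / 9 * D := by gcongr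
    _ ≤ D * (3 / 4) := by linarith

/-- Every y is the image of some z in [0,1] under one of the three maps, and the matching recursion
transfers the bound at z to y with a gain of 3/4. The induction therefore runs over all y at once.
-/
theorem tailCount_oscillation {c : ℝ}
    (hc : Tendsto (fun s => (tailCount s 1 : ℝ) / oddLambda ^ s) atTop (𝓝 c)) {C : ℝ} (hC0 : 0 < C)
    (hC : ∀ s, (tailCount s 1 : ℝ) / oddLambda ^ s ≤ C) (m : ℕ) {y : ℝ} (h0 : 0 ≤ y)
    (h1 : y ≤ 1) :
    ∃ N, ∀ s ≥ N, ∀ t ≥ N, |(tailCount s y : ℝ) / oddLambda ^ s - tailCount t y / oddLambda ^ t| ≤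
      C * (3 / 4) ^ m := by
  have hL := oddLambda_pos
  have hx0 : 0 < oddLambda⁻¹ := inv_pos.2 hL
  have hx := inv_oddLambda_le
  induction m generalizing y with
  | zero =>
    have hb : ∀ s, (0 : ℝ) ≤ tailCount s y / oddLambda ^ s ∧
        (tailCount s y : ℝ) / oddLambda ^ s ≤ C := by
      refine fun s => ⟨by positivity, le_trans ?_ (hC s)⟩
      gcongr
      exact tailCount_mono s h1
    refine ⟨0, fun s _ t _ => ?_⟩
    rw [pow_zero, mul_one, abs_le]
    constructor <;> linarith [(hb s).1, (hb s).2, (hb t).1, (hb t).2]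
  | succ m ih =>
    have hD : 0 < C * (3 / 4 : ℝ) ^ m := by positivity
    rw [pow_succ, ← mul_assoc]
    rcases le_or_gt y (1 / 3) with h3 | h3
    · have hz : 0 < 1 - 2 * y := by linarith
      have hy : y / (1 - 2 * y) / (1 + 2 * (y / (1 - 2 * y))) = y := by
        have h2 : 1 + 2 * (y / (1 - 2 * y)) = 1 / (1 - 2 * y) := by field_simp; ring
        rw [h2, div_div_div_cancel_right₀ hz.ne', div_one]
      have hz0 : 0 ≤ y / (1 - 2 * y) := by positivity
      have hz1 : y / (1 - 2 * y) ≤ 1 := by rw [div_le_one hz]; linarith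
      refine oscillation_step (k := 2) (σ := oddLambda⁻¹ ^ 2) (e := fun _ => 0) ?_ hD
        tendsto_const_nhds (ih hz0 hz1) ?_
      · rw [abs_of_pos (by positivity)]; nlinarith
      · intro s
        have := tailCount_div_one_add_two_mul s hz0 hz1
        rw [hy] at this
        rw [this]
        field_simp
        ring
    have hy0 : 0 < y := by linarith
    rcases le_or_gt y (1 / 2) with h2 | h2
    · have hz0 : 0 ≤ 3 - 1 / y := by rw [sub_nonneg, div_le_iff₀ hy0]; linarith
      have hz1 : 3 - 1 / y ≤ 1 := by rw [sub_le_comm, le_div_iff₀ hy0]; linarith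
      refine oscillation_step (k := 3) (σ := oddLambda⁻¹ ^ 3)
        (e := fun s => oddLambda⁻¹ ^ 2 * (tailCount (s + 1) 1 / oddLambda ^ (s + 1))) ?_ hD
        (((tendsto_add_atTop_iff_nat 1).2 hc).const_mul _) (ih hz0 hz1) ?_
      · rw [abs_of_pos (by positivity)]
        have : oddLambda⁻¹ ^ 3 ≤ (5 / 9) ^ 3 := by gcongr
        linarith
      · intro s
        have := tailCount_one_div_three_sub s hz0 hz1
        rw [sub_sub_cancel, one_div_one_div] at this
        rw [this]
        push_cast
        field_simp
        ring
    · have hz0 : 0 ≤ 1 / y - 1 := by rw [sub_nonneg, le_div_iff₀ hy0]; linarith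
      have hz1 : 1 / y - 1 ≤ 1 := by rw [sub_le_iff_le_add, div_le_iff₀ hy0]; linarith
      have ht := tendsto_tailCount_one_div_one_add_add hc hz0 hz1
      rw [add_sub_cancel, one_div_one_div] at ht
      refine oscillation_step (k := 1) (σ := -oddLambda⁻¹) ?_ hD ht (ih hz0 hz1) ?_
      · rwa [abs_neg, abs_of_pos hx0]
      · intro s
        ring

theorem exists_tendsto_tailCount {y : ℝ} (h0 : 0 ≤ y) (h1 : y ≤ 1) :
    ∃ l, Tendsto (fun s => (tailCount s y : ℝ) / oddLambda ^ s) atTop (𝓝 l) := by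
  obtain ⟨c, -, hc⟩ := exists_tendsto_tailCount_one
  obtain ⟨C, hC⟩ := hc.bddAbove_range
  have hC' : ∀ s, (tailCount s 1 : ℝ) / oddLambda ^ s ≤ C := fun s => hC ⟨s, rfl⟩
  have hC0 : 0 < C := by
    refine lt_of_lt_of_le ?_ (hC' 0)
    simpa using tailCount_one_pos 0
  apply cauchySeq_tendsto_of_complete
  rw [Metric.cauchySeq_iff]
  intro ε hε
  obtain ⟨m, hm⟩ := exists_pow_lt_of_lt_one (div_pos hε hC0) (by norm_num : (3 / 4 : ℝ) < 1)
  obtain ⟨N, hN⟩ := tailCount_oscillation hc hC0 hC' m h0 h1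
  refine ⟨N, fun s hs t ht => (hN s hs t ht).trans_lt ?_⟩
  rw [lt_div_iff₀ hC0] at hm
  linarith

/-! ### The distribution function and its functional equations -/

theorem oddFn_eq (n : ℕ) (x : ℝ) :
    oddFn n x = 1 - (tailCount (n + 1) (1 - x) : ℝ) / (tailCount (n + 1) 1 + 1) := by
  have hinj (S : Set ℚ) : Set.InjOn (fun ξ : ℚ => 1 - ξ) S := fun a _ b _ h => by simpa using h
  have hM : (oddM n).ncard = (tailSet (n + 1)).ncard := by
    rw [← (hinj (oddM n)).ncard_image]
    congr 1
    ext η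
    constructor
    · rintro ⟨ξ, hξ, rfl⟩
      exact mem_oddM_iff.1 hξ
    · exact fun h => ⟨1 - η, mem_oddM_iff.2 (by simpa using h), by simp⟩
  have hS : {ξ : ℚ | ξ ∈ oddM n ∧ (ξ : ℝ) ≤ x}.ncard =
      {η : ℚ | η ∈ tailSet (n + 1) ∧ 1 - x ≤ (η : ℝ)}.ncard := by
    rw [← (hinj _).ncard_image]
    congr 1
    ext η
    constructor
    · rintro ⟨ξ, ⟨hξ, h⟩, rfl⟩
      exact ⟨mem_oddM_iff.1 hξ, by push_cast; linarith⟩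
    · rintro ⟨h, h'⟩
      exact ⟨1 - η, ⟨mem_oddM_iff.2 (by simpa using h), by push_cast; linarith⟩, by simp⟩
  have h := tailCount_add_ncard_ge (n + 1) (1 - x)
  rw [ncard_tailSet] at h
  have h' : ((tailCount (n + 1) (1 - x) : ℝ) +
      ({η : ℚ | η ∈ tailSet (n + 1) ∧ 1 - x ≤ (η : ℝ)}.ncard : ℝ)) =
      tailCount (n + 1) 1 + 1 := by exact_mod_cast h
  rw [oddFn, hM, hS, ncard_tailSet, eq_sub_of_add_eq' h']
  push_cast
  rw [sub_div, div_self (by positivity)]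

theorem tendsto_oddFn {c : ℝ} (hc0 : 0 < c)
    (hc : Tendsto (fun s => (tailCount s 1 : ℝ) / oddLambda ^ s) atTop (𝓝 c)) {x l : ℝ}
    (hl : Tendsto (fun s => (tailCount s (1 - x) : ℝ) / oddLambda ^ s) atTop (𝓝 l)) :
    Tendsto (fun n => oddFn n x) atTop (𝓝 (1 - l / c)) := by
  have hd := (hc.add tendsto_inv_oddLambda_pow)
  rw [add_zero] at hd
  have hq := (tendsto_add_atTop_iff_nat 1).2 (hl.div hd hc0.ne')
  refine (hq.const_sub 1).congr fun n => ?_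
  have hL := oddLambda_pos
  rw [oddFn_eq, Pi.div_apply, ← add_div, div_div_div_cancel_right₀ (by positivity)]

theorem tendsto_oddF {x : ℝ} (hx : x ∈ Set.Icc (0 : ℝ) 1) :
    Tendsto (fun n => oddFn n x) atTop (𝓝 (oddF x)) := by
  obtain ⟨c, hc0, hc⟩ := exists_tendsto_tailCount_one
  obtain ⟨l, hl⟩ := exists_tendsto_tailCount (y := 1 - x) (by linarith [hx.2]) (by linarith [hx.1])
  exact tendsto_nhds_limUnder ⟨_, tendsto_oddFn hc0 hc hl⟩

/-- One constant c serves for all y, so limits of the counting recursions become identities for F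
after cancelling c. -/
theorem exists_tendsto_tailCount_eq_oddF :
    ∃ c, 0 < c ∧ Tendsto (fun s => (tailCount s 1 : ℝ) / oddLambda ^ s) atTop (𝓝 c) ∧
      ∀ y ∈ Set.Icc (0 : ℝ) 1, Tendsto (fun s => (tailCount s y : ℝ) / oddLambda ^ s) atTop
        (𝓝 (c * (1 - oddF (1 - y)))) := by
  obtain ⟨c, hc0, hc⟩ := exists_tendsto_tailCount_one
  refine ⟨c, hc0, hc, fun y hy => ?_⟩
  obtain ⟨l, hl⟩ := exists_tendsto_tailCount hy.1 hy.2
  have h := tendsto_oddFn (x := 1 - y) hc0 hc (by simpa using hl)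
  have := tendsto_nhds_unique h (tendsto_oddF ⟨by linarith [hy.2], by linarith [hy.1]⟩)
  rw [← this, sub_sub_cancel, mul_div_cancel₀ _ hc0.ne']
  exact hl

theorem one_sub_oddF_one : 1 - oddF (1 - 0) = 0 := by
  obtain ⟨c, hc0, -, h⟩ := exists_tendsto_tailCount_eq_oddF
  have h0 := h 0 (by simp)
  simp only [tailCount_zero, Nat.cast_zero, zero_div] at h0
  have := tendsto_nhds_unique h0 tendsto_const_nhds
  simpa [hc0.ne'] using this

theorem oddF_one_div_one_add {y : ℝ} (hy : y ∈ Set.Icc (0 : ℝ) 1) :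
    1 - oddF (1 - 1 / (1 + y)) = 1 - (1 - oddF (1 - y)) / oddLambda := by
  obtain ⟨c, hc0, hc, h⟩ := exists_tendsto_tailCount_eq_oddF
  have h0 := hy.1
  have h1 := (tendsto_add_atTop_iff_nat 1).2 (h (1 / (1 + y))
    ⟨by positivity, (div_le_one (by positivity)).2 (by linarith)⟩)
  have := tendsto_nhds_unique (h1.add ((h y hy).const_mul oddLambda⁻¹))
    (tendsto_tailCount_one_div_one_add_add hc hy.1 hy.2)
  apply mul_left_cancel₀ hc0.ne'
  rw [div_eq_mul_inv (1 - oddF (1 - y))]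
  linear_combination this

theorem oddF_div_one_add_two_mul {y : ℝ} (hy : y ∈ Set.Icc (0 : ℝ) 1) :
    1 - oddF (1 - y / (1 + 2 * y)) = (1 - oddF (1 - y)) / oddLambda ^ 2 := by
  obtain ⟨c, hc0, hc, h⟩ := exists_tendsto_tailCount_eq_oddF
  have h0 := hy.1
  have h1 := (tendsto_add_atTop_iff_nat 2).2 (h (y / (1 + 2 * y))
    ⟨by positivity, (div_le_one (by positivity)).2 (by linarith)⟩)
  have h2 := (h y hy).const_mul (oddLambda ^ 2)⁻¹
  have := tendsto_nhds_unique h1 (h2.congr fun s => by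
    rw [tailCount_div_one_add_two_mul s hy.1 hy.2, pow_add]
    have := oddLambda_pos
    field_simp)
  apply mul_left_cancel₀ hc0.ne'
  rw [div_eq_mul_inv (1 - oddF (1 - y))]
  linear_combination this

theorem oddF_div_one_add_two_mul_nat {y : ℝ} (hy : y ∈ Set.Icc (0 : ℝ) 1) (m : ℕ) :
    1 - oddF (1 - y / (1 + 2 * m * y)) = (1 - oddF (1 - y)) / oddLambda ^ (2 * m) := by
  have h0 := hy.1
  induction m with
  | zero => simp
  | succ m ih =>
    have hb : y / (1 + 2 * m * y) ∈ Set.Icc (0 : ℝ) 1 := by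
      refine ⟨by positivity, (div_le_one (by positivity)).2 ?_⟩
      have : 0 ≤ 2 * m * y := by positivity
      linarith [hy.2]
    have h := oddF_div_one_add_two_mul hb
    rw [ih, div_div _ (oddLambda ^ _), ← pow_add] at h
    rw [mul_add_one, ← h]
    congr 3
    push_cast
    field_simp
    ring

theorem proposition1 :
    (∀ x ∈ Set.Icc (0 : ℝ) 1, Tendsto (fun n : ℕ => oddFn n x) atTop (𝓝 (oddF x))) ∧
    (∀ n : ℕ, 1 ≤ n → ∀ x ∈ Set.Icc (0 : ℝ) 1,
      (1 - oddF (1 - x)) / oddLambda ^ (2 * n - 1) =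
        1 / oddLambda ^ (2 * n - 2) - 1 + oddF (1 - 1 / (2 * (n : ℝ) - 1 + x))) ∧
    (∀ n : ℕ, 1 ≤ n → ∀ x ∈ Set.Ioc (0 : ℝ) 1,
      (1 - oddF (1 - x)) / oddLambda ^ (2 * n) =
        1 - oddF (1 - 1 / (2 * (n : ℝ) + 1 / x))) ∧
    (∀ n : ℕ, 1 ≤ n →
      (1 - oddF (1 - 0)) / oddLambda ^ (2 * n) = 1 - oddF (1 - 0)) := by
  refine ⟨fun x hx => tendsto_oddF hx, fun n hn x hx => ?_, fun n _ x hx => ?_, fun n _ => ?_⟩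
  · obtain ⟨m, rfl⟩ := Nat.exists_eq_add_of_le' hn
    have h0 := hx.1
    have hz : 1 / (1 + x) ∈ Set.Icc (0 : ℝ) 1 :=
      ⟨by positivity, (div_le_one (by positivity)).2 (by linarith)⟩
    -- With n = m + 1, the denominator 2n - 1 + x is (1 + x) + 2m: the map 1/(1+x) followed by m
    -- steps of the second map.
    have h := oddF_div_one_add_two_mul_nat hz m
    have e : 1 / (1 + x) / (1 + 2 * m * (1 / (1 + x))) = 1 / (2 * ((m + 1 : ℕ) : ℝ) - 1 + x) := by
      have h2 : 2 * ((m + 1 : ℕ) : ℝ) - 1 + x = 1 + x + 2 * m := by push_cast; ring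
      rw [h2]
      field_simp
    rw [e, oddF_one_div_one_add hx, sub_div, div_div, ← pow_succ'] at h
    rw [show 2 * (m + 1) - 1 = 2 * m + 1 by omega, show 2 * (m + 1) - 2 = 2 * m by omega]
    linarith
  · have h0 := hx.1
    rw [← oddF_div_one_add_two_mul_nat ⟨hx.1.le, hx.2⟩ n]
    congr 3
    field_simp
    ring
  · rw [one_sub_oddF_one, zero_div]
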